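/- For integers $p\ge 1$, $0\le k\le p$ and reals $0<M_1<M_0<\infty$, let $\mathcal C_p$ be the set of all $p\times p$ symmetric positive definite real matrices and let $$\mathcal B_{p,k}=\{\Sigma=(\sigma_{ij})\in\mathcal C_p:\ \sigma_{ij}=0 \text{ if } |i-j|>k,\ \lambda_{\max}(\Sigma)\le M_0,\ \lambda_{\min}(\Sigma)\ge M_1\}.$$ Let $\Pi^*$ be the set of all pairs $(\pi,f)$ of a prior $\pi$ (a probability measure on $\mathcal C_p$) and a measurable post-processing function $f:\mathcal C_p\to\mathbb R^{p\times p}$. For $\mathbb X_n=(X_1,\dots,X_n)$ with $n\ge 1$, let $E^{\pi}(\,\cdot\mid\mathbb X_n)$ be the expectation over the posterior distribution of $\Sigma$, given $\mathbb X_n$, for the prior $\pi$ and the model in which $X_1,\dots,X_n$ are i.i.d. $N_p(0,\Sigma)$. Let $E_{\Sigma_0}$ be the expectation over $X_1,\dots,X_n$ i.i.d. $N_p(0,\Sigma_0)$, and let $\|\cdot\|$ be the spectral norm. There is a constant $C>0$ depending only on $M_0$ and $M_1$ such that for all such $n,p,k$ with $n/2\ge \max\big\{\min\{(M_0-M_1)^2,1\}\log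 p,\ k\big\}$, $$\inf_{(\pi,f)\in\Pi^*}\ \sup_{\Sigma_0\in\mathcal B_{p,k}} E_{\Sigma_0}\Big[E^{\pi}\big(\|f(\Sigma)-\Sigma_0\|^2\mid\mathbb X_n\big)\Big]\ \ge\ C\,\frac{k+\log p}{n}.$$ -/

import Mathlib

open MeasureTheory ProbabilityTheory
open scoped ENNReal

noncomputable section

namespace BandedCovariance

/-- The Borel σ-algebra on real `p × p` matrices (the product σ-algebra of the entries). -/
instance matMeasurableSpace (p : ℕ) : MeasurableSpace (Matrix (Fin p) (Fin p) ℝ) :=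
  inferInstanceAs (MeasurableSpace (Fin p → Fin p → ℝ))

instance matBorelSpace (p : ℕ) : BorelSpace (Matrix (Fin p) (Fin p) ℝ) :=
  inferInstanceAs (BorelSpace (Fin p → Fin p → ℝ))

instance matStandardBorelSpace (p : ℕ) : StandardBorelSpace (Matrix (Fin p) (Fin p) ℝ) :=
  inferInstanceAs (StandardBorelSpace (Fin p → Fin p → ℝ))

/-- `𝒞_p`: the set of all `p × p` (symmetric) positive definite real matrices. -/
abbrev PosDefMatrix (p : ℕ) : Type := {S : Matrix (Fin p) (Fin p) ℝ // S.PosDef}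

theorem measurableSet_posDef (p : ℕ) :
    MeasurableSet {S : Matrix (Fin p) (Fin p) ℝ | S.PosDef} := by
  have h1 : IsClosed {S : Matrix (Fin p) (Fin p) ℝ | S.PosSemidef} := by
    have : {S : Matrix (Fin p) (Fin p) ℝ | S.PosSemidef} =
        {S | S.conjTranspose = S} ∩
          ⋂ x : Fin p → ℝ, {S | 0 ≤ dotProduct (star x) (S.mulVec x)} := by
      ext S
      simp [Matrix.posSemidef_iff_dotProduct_mulVec, Matrix.IsHermitian]
    rw [this]
    refine (isClosed_eq (by fun_prop) (by fun_prop)).inter (isClosed_iInter fun x => ?_)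
    exact isClosed_le (by fun_prop) (by fun_prop)
  have h2 : IsOpen {S : Matrix (Fin p) (Fin p) ℝ | S.det ≠ 0} :=
    isOpen_ne_fun (by fun_prop) (by fun_prop)
  have h3 : {S : Matrix (Fin p) (Fin p) ℝ | S.PosDef} =
      {S | S.PosSemidef} ∩ {S | S.det ≠ 0} := by
    ext S
    constructor
    · exact fun h => ⟨h.posSemidef, h.posSemidef.posDef_iff_det_ne_zero.1 h⟩
    · exact fun h => h.1.posDef_iff_det_ne_zero.2 h.2
  rw [h3]
  exact h1.measurableSet.inter h2.measurableSet

instance posDefStandardBorelSpace (p : ℕ) : StandardBorelSpace (PosDefMatrix p) :=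
  (measurableSet_posDef p).standardBorel

instance posDefNonempty (p : ℕ) : Nonempty (PosDefMatrix p) := ⟨⟨1, Matrix.PosDef.one⟩⟩

/-- The spectral norm (the operator norm for the Euclidean norm) of a real `p × p` matrix. -/
def specNorm {p : ℕ} (A : Matrix (Fin p) (Fin p) ℝ) : ℝ :=
  ‖Matrix.toEuclideanCLM (𝕜 := ℝ) A‖

/-- `ℬ_{p,k}(M₀, M₁)`: the positive definite `p × p` matrices with bandwidth `k`
whose eigenvalues all lie in `[M₁, M₀]`. -/
def bandedClass (p k : ℕ) (M₀ M₁ : ℝ) : Set (PosDefMatrix p) :=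
  {S | (∀ i j : Fin p, (k : ℤ) < |(i : ℤ) - (j : ℤ)| → S.1 i j = 0) ∧
    ∀ i, S.2.isHermitian.eigenvalues i ≤ M₀ ∧ M₁ ≤ S.2.isHermitian.eigenvalues i}

/-- The data: `n` observations in `ℝ^p`. -/
abbrev Sample (n p : ℕ) : Type := Fin n → EuclideanSpace ℝ (Fin p)

/-- The law of `n` independent `N_p(0, S)` observations. -/
def sampleLaw (n : ℕ) {p : ℕ} (S : PosDefMatrix p) : Measure (Sample n p) :=
  Measure.pi fun _ : Fin n => multivariateGaussian (0 : EuclideanSpace ℝ (Fin p)) S.1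

theorem measurable_toEuclideanCLM {α : Type} [MeasurableSpace α] {p : ℕ}
    {A : α → Matrix (Fin p) (Fin p) ℝ} {x : α → EuclideanSpace ℝ (Fin p)}
    (hA : Measurable A) (hx : Measurable x) :
    Measurable fun q : α =>
      (0 : EuclideanSpace ℝ (Fin p)) + Matrix.toEuclideanCLM (𝕜 := ℝ) (A q) (x q) := by
  simp only [zero_add]
  have : Measurable fun q : α => WithLp.toLp 2 (fun i => ∑ j, A q i j * x q j) := by
    refine (WithLp.measurable_toLp 2 (Fin p → ℝ)).comp (measurable_pi_lambda _ fun i => ?_)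
    refine Finset.measurable_sum _ fun j _ => ?_
    have h1 : Measurable fun A : Matrix (Fin p) (Fin p) ℝ => A i j :=
      (measurable_pi_apply j).comp
        (measurable_pi_apply (X := fun _ : Fin p => Fin p → ℝ) i)
    have h2 : Measurable fun x : EuclideanSpace ℝ (Fin p) => x j := by fun_prop
    exact (h1.comp hA).mul (h2.comp hx)
  exact this

section Measurability

open scoped MatrixOrder

open scoped Matrix.Norms.L2Operator in
theorem continuous_sqrt_posDef (p : ℕ) :
    Continuous fun S : PosDefMatrix p => (CFC.sqrt S.1 : Matrix (Fin p) (Fin p) ℝ) :=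
  CFC.continuousOn_sqrt.comp_continuous continuous_subtype_val
    fun S => S.2.posSemidef.nonneg

theorem measurable_sqrt (p : ℕ) :
    Measurable fun S : PosDefMatrix p => (CFC.sqrt S.1 : Matrix (Fin p) (Fin p) ℝ) := by
  exact (continuous_sqrt_posDef p).measurable

/-- The linear map `x ↦ S^{1/2} x` that sends a standard Gaussian vector to an `N_p(0, S)` one. -/
def colorMap {p : ℕ} (S : PosDefMatrix p) (x : EuclideanSpace ℝ (Fin p)) :
    EuclideanSpace ℝ (Fin p) :=
  0 + Matrix.toEuclideanCLM (𝕜 := ℝ) (CFC.sqrt S.1) x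

theorem measurable_colorMap (p : ℕ) :
    Measurable fun q : PosDefMatrix p × EuclideanSpace ℝ (Fin p) => colorMap q.1 q.2 := by
  have h1 : Measurable fun q : PosDefMatrix p × EuclideanSpace ℝ (Fin p) =>
      (CFC.sqrt q.1.1 : Matrix (Fin p) (Fin p) ℝ) :=
    Measurable.comp (g := fun S : PosDefMatrix p => (CFC.sqrt S.1 : Matrix (Fin p) (Fin p) ℝ))
      (measurable_sqrt p) measurable_fst
  exact measurable_toEuclideanCLM h1 measurable_snd

theorem multivariateGaussian_eq_map_colorMap {p : ℕ} (S : PosDefMatrix p) :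
    multivariateGaussian (0 : EuclideanSpace ℝ (Fin p)) S.1 =
      (stdGaussian (EuclideanSpace ℝ (Fin p))).map (colorMap S) := rfl

end Measurability

theorem measurable_map_family {α β γ : Type} [MeasurableSpace α] [MeasurableSpace β]
    [MeasurableSpace γ] (ν : Measure β) [SFinite ν] {F : α → β → γ}
    (hF : Measurable fun q : α × β => F q.1 q.2) : Measurable fun a => ν.map (F a) := by
  refine Measure.measurable_of_measurable_coe _ fun s hs => ?_
  have heq : (fun a => ν.map (F a) s) =
      fun a => ν (Prod.mk a ⁻¹' ((fun q : α × β => F q.1 q.2) ⁻¹' s)) := by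
    funext a
    have ha : Measurable (F a) := hF.comp (measurable_prodMk_left (x := a))
    rw [Measure.map_apply ha hs]
    rfl
  rw [heq]
  exact measurable_measure_prodMk_left (hF hs)

theorem sampleLaw_eq_map_colorMap (n : ℕ) {p : ℕ} (S : PosDefMatrix p) : sampleLaw n S =
    (Measure.pi fun _ : Fin n => stdGaussian (EuclideanSpace ℝ (Fin p))).map
      fun z i => colorMap S (z i) := by
  have hS : Measurable (colorMap S) :=
    Measurable.comp
      (g := fun q : PosDefMatrix p × EuclideanSpace ℝ (Fin p) => colorMap q.1 q.2)
      (f := fun x => (S, x)) (measurable_colorMap p) measurable_prodMk_left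
  have : IsProbabilityMeasure ((stdGaussian (EuclideanSpace ℝ (Fin p))).map (colorMap S)) :=
    Measure.isProbabilityMeasure_map hS.aemeasurable
  rw [sampleLaw, multivariateGaussian_eq_map_colorMap]
  exact (Measure.pi_map_pi fun _ => hS.aemeasurable).symm

theorem measurable_sampleLaw (n p : ℕ) :
    Measurable fun S : PosDefMatrix p => sampleLaw n S := by
  have hpi : Measurable fun q : PosDefMatrix p × Sample n p =>
      fun i : Fin n => colorMap q.1 (q.2 i) :=
    measurable_pi_lambda _ fun i => Measurable.comp
      (g := fun q : PosDefMatrix p × EuclideanSpace ℝ (Fin p) => colorMap q.1 q.2)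
      (f := fun q : PosDefMatrix p × Sample n p => (q.1, q.2 i)) (measurable_colorMap p)
      (measurable_fst.prodMk ((measurable_pi_apply i).comp measurable_snd))
  have h := measurable_map_family
    (Measure.pi fun _ : Fin n => stdGaussian (EuclideanSpace ℝ (Fin p)))
    (F := fun (S : PosDefMatrix p) (z : Sample n p) (i : Fin n) => colorMap S (z i)) hpi
  rw [show (fun S : PosDefMatrix p => sampleLaw n S) = _ from
    funext fun S => sampleLaw_eq_map_colorMap n S]
  exact h

/-- The statistical model `S ↦ N_p(0, S)^{⊗ n}` as a Markov kernel. -/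
def model (n p : ℕ) : Kernel (PosDefMatrix p) (Sample n p) where
  toFun S := sampleLaw n S
  measurable' := measurable_sampleLaw n p

instance modelIsMarkovKernel (n p : ℕ) : IsMarkovKernel (model n p) :=
  ⟨fun S => by
    change IsProbabilityMeasure (sampleLaw n S)
    unfold sampleLaw
    infer_instance⟩

/-- A post-processed posterior procedure: a prior, which is a probability measure on `𝒞_p`,
together with a (measurable) post-processing function. No restriction is put on the range of the
post-processing function. -/
structure Procedure (p : ℕ) where
  /-- the prior -/
  prior : ProbabilityMeasure (PosDefMatrix p)
  /-- the post-processing function -/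
  post : PosDefMatrix p → Matrix (Fin p) (Fin p) ℝ
  measurable_post : Measurable post

/-- The loss `E^π (‖f(S) - S₀‖² ∣ x)`: the expectation is over the posterior law of `S` given the
data `x` for the prior `π`. -/
def pLoss {n p : ℕ} (d : Procedure p) (S₀ : PosDefMatrix p) (x : Sample n p) : ℝ≥0∞ :=
  ∫⁻ S, ENNReal.ofReal (specNorm (d.post S - S₀.1) ^ 2)
    ∂(posterior (model n p) (d.prior : Measure (PosDefMatrix p)) x)

/-- The risk `E_{S₀} {E^π (‖f(S) - S₀‖² ∣ X_1, …, X_n)}` with `X_1, …, X_n` i.i.d. `N_p(0, S₀)`. -/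
def pRisk (n : ℕ) {p : ℕ} (d : Procedure p) (S₀ : PosDefMatrix p) : ℝ≥0∞ :=
  ∫⁻ x, pLoss d S₀ x ∂(sampleLaw n S₀)

/-- The minimax risk over `ℬ_{p,k}(M₀, M₁)` among all post-processed posterior procedures. -/
def minimaxRisk (n p k : ℕ) (M₀ M₁ : ℝ) : ℝ≥0∞ :=
  ⨅ d : Procedure p, ⨆ S₀ ∈ bandedClass p k M₀ M₁, pRisk n d S₀

end BandedCovariance

end

namespace BandedCovariance

/-! A post-processed posterior can be treated like an estimator: the posterior depends only on the
data, so averaging `‖S - T‖² ≤ 2‖f - S‖² + 2‖f - T‖²` over it shows that no procedure has small loss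
at two separated covariances (`specNorm_sq_div_two_le_pLoss_add`). Le Cam's method then applies
(`half_le_lintegral_add_sum`): `M₀ I` is tested against the uniform mixture of `M₀ (1 - s v vᵀ)`
over finitely many unit vectors `v`. The separation is `M₀ s`, and the second moment of the mixture
likelihood ratio is at most the average of `exp (n s² ⟨v, w⟩²)`, so a risk of order `s²` is forced
once that average is at most 2 (`ofReal_le_minimaxRisk`). Two families suffice. Sign vectors on `k`
coordinates allow `s² ≍ k / n`, since `⟨v, w⟩` is a normalised Rademacher sum; coordinate vectors
allow `s² ≍ log p / n`, since only the `p` diagonal pairs interact. The larger of the two bounds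
dominates half their sum. -/

/-! ### Gaussian integrals and product measures. -/

theorem integral_exp_quadratic_gaussianReal (a : ℝ) {b : ℝ} (hb : -1 < b) :
    ∫ h, Real.exp (a * h - b * h ^ 2 / 2) ∂(gaussianReal 0 1) =
      (√(1 + b))⁻¹ * Real.exp (a ^ 2 / (2 * (1 + b))) := by
  have hb' : 0 < 1 + b := by linarith
  rw [integral_gaussianReal_eq_integral_smul one_ne_zero]
  have key : ∀ h : ℝ, gaussianPDFReal 0 1 h • Real.exp (a * h - b * h ^ 2 / 2) =
      ((√(2 * Real.pi))⁻¹ * Real.exp (a ^ 2 / (2 * (1 + b)))) *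
        Real.exp (-((1 + b) / 2) * (h - a / (1 + b)) ^ 2) := by
    intro h
    simp only [gaussianPDFReal, NNReal.coe_one, mul_one, sub_zero, smul_eq_mul]
    rw [mul_assoc, mul_assoc, ← Real.exp_add, ← Real.exp_add]
    congr 2
    field_simp
    ring
  simp_rw [key]
  rw [integral_const_mul, integral_sub_right_eq_self
    (fun h : ℝ => Real.exp (-((1 + b) / 2) * h ^ 2)), integral_gaussian]
  have : √(Real.pi / ((1 + b) / 2)) = √(2 * Real.pi) * (√(1 + b))⁻¹ := by
    rw [← Real.sqrt_inv, ← Real.sqrt_mul (by positivity)]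
    congr 1
    field_simp
  rw [this]
  have : √(2 * Real.pi) ≠ 0 := by positivity
  field_simp

/-- The Bochner integral of a non-integrable function is 0, whereas the value computed above is
positive. -/
theorem integrable_exp_quadratic_gaussianReal (a : ℝ) {b : ℝ} (hb : -1 < b) :
    Integrable (fun h => Real.exp (a * h - b * h ^ 2 / 2)) (gaussianReal 0 1) := by
  by_contra hn
  have h := integral_exp_quadratic_gaussianReal a hb
  rw [integral_undef hn] at h
  have : 0 < 1 + b := by linarith
  exact (by positivity : (√(1 + b))⁻¹ * Real.exp (a ^ 2 / (2 * (1 + b))) ≠ 0) h.symm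

theorem lintegral_pi_prod {ι Ω : Type*} [Fintype ι] [MeasurableSpace Ω] (μ : Measure Ω)
    [IsProbabilityMeasure μ] {f : ι → Ω → ℝ≥0∞} (hf : ∀ i, Measurable (f i)) :
    ∫⁻ x, ∏ i, f i (x i) ∂(Measure.pi fun _ : ι => μ) = ∏ i, ∫⁻ x, f i x ∂μ := by
  have hind : iIndepFun (fun i (x : ι → Ω) => f i (x i)) (Measure.pi fun _ : ι => μ) :=
    iIndepFun_pi fun i => (hf i).aemeasurable
  have h := lintegral_prod_eq_prod_lintegral_of_indepFun Finset.univ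
    (fun i (x : ι → Ω) => f i (x i)) hind fun i => (hf i).comp (measurable_pi_apply i)
  rw [h]
  refine Finset.prod_congr rfl fun i _ => ?_
  exact (measurePreserving_eval (fun _ : ι => μ) i).lintegral_comp (hf i)

theorem pi_withDensity {ι Ω : Type*} [Fintype ι] [MeasurableSpace Ω] (μ : Measure Ω)
    [IsProbabilityMeasure μ] {f : Ω → ℝ≥0∞} (hf : Measurable f)
    [IsProbabilityMeasure (μ.withDensity f)] :
    Measure.pi (fun _ : ι => μ.withDensity f) =
      (Measure.pi fun _ : ι => μ).withDensity fun x => ∏ i, f (x i) := by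
  refine Measure.pi_eq fun s hs => ?_
  rw [withDensity_apply _ (MeasurableSet.univ_pi hs),
    ← lintegral_indicator (MeasurableSet.univ_pi hs)]
  have : ∀ x : ι → Ω, (Set.univ.pi s).indicator (fun x => ∏ i, f (x i)) x =
      ∏ i, (s i).indicator f (x i) := by
    intro x
    by_cases hx : x ∈ Set.univ.pi s
    · rw [Set.indicator_of_mem hx]
      exact Finset.prod_congr rfl fun i _ => (Set.indicator_of_mem (hx i trivial) f).symm
    · rw [Set.indicator_of_notMem hx]
      simp only [Set.mem_pi, Set.mem_univ, true_imp_iff, not_forall] at hx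
      obtain ⟨i, hi⟩ := hx
      exact (Finset.prod_eq_zero (Finset.mem_univ i) (Set.indicator_of_notMem hi f)).symm
  simp_rw [this]
  rw [lintegral_pi_prod μ fun i => hf.indicator (hs i)]
  refine Finset.prod_congr rfl fun i _ => ?_
  rw [lintegral_indicator (hs i), withDensity_apply _ (hs i)]

/-! ### Spiked covariances and their likelihood ratios. -/

/-- The covariance matrix `M (1 - s v vᵀ)`. -/
noncomputable def spiked {p : ℕ} (M s : ℝ) (v : EuclideanSpace ℝ (Fin p)) :
    Matrix (Fin p) (Fin p) ℝ :=
  M • (1 - s • Matrix.vecMulVec v v)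

variable {p : ℕ} {M s : ℝ} {v w : EuclideanSpace ℝ (Fin p)}

theorem spiked_mulVec (M s : ℝ) (v : EuclideanSpace ℝ (Fin p)) (x : EuclideanSpace ℝ (Fin p)) :
    (spiked M s v).mulVec x = M • ((x : Fin p → ℝ) - (s * inner ℝ v x) • (v : Fin p → ℝ)) := by
  ext i
  simp only [spiked, Matrix.smul_mulVec, Matrix.sub_mulVec, Matrix.one_mulVec,
    Matrix.vecMulVec_mulVec, Pi.smul_apply, Pi.sub_apply, smul_eq_mul, PiLp.inner_apply]
  simp [dotProduct, mul_comm, mul_left_comm]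

theorem dotProduct_spiked_mulVec (M s : ℝ) (v x : EuclideanSpace ℝ (Fin p)) :
    dotProduct (x : Fin p → ℝ) ((spiked M s v).mulVec x) =
      M * (‖x‖ ^ 2 - s * inner ℝ v x ^ 2) := by
  rw [spiked_mulVec, dotProduct_smul, dotProduct_sub, dotProduct_smul]
  have h1 : dotProduct (x : Fin p → ℝ) (x : Fin p → ℝ) = ‖x‖ ^ 2 := by
    rw [EuclideanSpace.real_norm_sq_eq]; simp [dotProduct, sq]
  have h2 : dotProduct (x : Fin p → ℝ) (v : Fin p → ℝ) = inner ℝ v x := by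
    simp [PiLp.inner_apply, dotProduct]
  rw [h1, h2]
  simp only [smul_eq_mul]
  ring

theorem spiked_isHermitian (M s : ℝ) (v : EuclideanSpace ℝ (Fin p)) :
    (spiked M s v).IsHermitian := by
  ext i j
  simp [spiked, Matrix.vecMulVec_apply, Matrix.one_apply, eq_comm, mul_comm (v i)]

theorem spiked_posDef (hM : 0 < M) (hs0 : 0 ≤ s) (hs1 : s < 1) (hv : ‖v‖ = 1) :
    (spiked M s v).PosDef := by
  refine Matrix.PosDef.of_dotProduct_mulVec_pos (spiked_isHermitian M s v) fun x hx => ?_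
  have h := dotProduct_spiked_mulVec M s v (WithLp.toLp 2 x)
  simp only [star_trivial]
  rw [h]
  have hx' : 0 < ‖WithLp.toLp 2 x‖ := norm_pos_iff.2 fun h0 => hx (by simpa using h0)
  have h1 : |inner ℝ v (WithLp.toLp 2 x)| ≤ ‖WithLp.toLp 2 x‖ := by
    simpa [hv] using abs_real_inner_le_norm v (WithLp.toLp 2 x)
  have h2 : inner ℝ v (WithLp.toLp 2 x) ^ 2 ≤ ‖WithLp.toLp 2 x‖ ^ 2 :=
    sq_le_sq.2 (by simpa using h1)
  have : 0 < ‖WithLp.toLp 2 x‖ ^ 2 := by positivity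
  exact mul_pos hM (by nlinarith)

theorem charFun_spiked (hM : 0 < M) (hs0 : 0 ≤ s) (hs1 : s < 1) (hv : ‖v‖ = 1)
    (t : EuclideanSpace ℝ (Fin p)) :
    charFun (multivariateGaussian 0 (spiked M s v)) t =
      (Real.exp (-(M * (‖t‖ ^ 2 - s * inner ℝ v t ^ 2) / 2)) : ℂ) := by
  rw [charFun_multivariateGaussian (spiked_posDef hM hs0 hs1 hv).posSemidef,
    dotProduct_spiked_mulVec]
  simp

/-- The density of `N(0, M (1 - s v vᵀ))` with respect to `N(0, M)`. -/
noncomputable def spikedDensity (M s : ℝ) (v x : EuclideanSpace ℝ (Fin p)) : ℝ :=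
  (√(1 - s))⁻¹ * Real.exp (-(s / (1 - s) / M) * inner ℝ v x ^ 2 / 2)

theorem spikedDensity_nonneg (M s : ℝ) (v x : EuclideanSpace ℝ (Fin p)) :
    0 ≤ spikedDensity M s v x := by
  unfold spikedDensity; positivity

theorem measurable_spikedDensity (M s : ℝ) (v : EuclideanSpace ℝ (Fin p)) :
    Measurable (spikedDensity M s v) := by
  unfold spikedDensity; fun_prop

theorem map_inner_spiked (hM : 0 < M) (hs0 : 0 ≤ s) (hs1 : s < 1) (hw : ‖w‖ = 1) (v) :
    (multivariateGaussian 0 (spiked M s w)).map (fun x => inner ℝ v x) =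
      (gaussianReal 0 1).map (fun h => √(M * (‖v‖ ^ 2 - s * inner ℝ w v ^ 2)) * h) := by
  have hnn : 0 ≤ M * (‖v‖ ^ 2 - s * inner ℝ w v ^ 2) := by
    rw [← dotProduct_spiked_mulVec]
    simpa using (spiked_posDef hM hs0 hs1 hw).posSemidef.dotProduct_mulVec_nonneg v.ofLp
  refine Measure.ext_of_charFun ?_
  ext t
  rw [gaussianReal_map_const_mul, charFun_gaussianReal, charFun_apply_real,
    integral_map (by fun_prop) (by fun_prop)]
  have := charFun_spiked hM hs0 hs1 hw (t • v)
  rw [charFun_apply] at this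
  simp_rw [real_inner_smul_right] at this
  simp_rw [real_inner_comm _ v]
  push_cast at this ⊢
  rw [this]
  rw [norm_smul]
  simp
  rw [← Complex.ofReal_pow (√_), Real.sq_sqrt hnn, mul_pow, ← Complex.ofReal_pow |t|, sq_abs]
  push_cast
  ring_nf

/-- The cross moment of two likelihood ratios for one observation. With `ρ = ⟨v, w⟩²`, the
projection `⟨v, x⟩` is centred Gaussian of variance `M (1 - s ρ)`, and the normalisations combine
through `(1 - s) + s (1 - s ρ) = 1 - s² ρ`. -/
theorem lintegral_spikedDensity_spiked (hM : 0 < M) (hs0 : 0 ≤ s) (hs1 : s < 1)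
    (hv : ‖v‖ = 1) (hw : ‖w‖ = 1) :
    ∫⁻ x, ENNReal.ofReal (spikedDensity M s v x) ∂(multivariateGaussian 0 (spiked M s w)) =
      ENNReal.ofReal ((√(1 - s ^ 2 * inner ℝ v w ^ 2))⁻¹) := by
  have hρ : inner ℝ v w ^ 2 ≤ 1 := by
    have := abs_real_inner_le_norm v w
    rw [hv, hw, mul_one] at this
    rw [← sq_abs]
    exact pow_le_one₀ (abs_nonneg _) this
  set ρ := inner ℝ v w ^ 2
  have hs : 0 < 1 - s := by linarith
  have hσ : 0 ≤ M * (1 - s * ρ) := mul_nonneg hM.le (by nlinarith)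
  have hb : 0 ≤ s / (1 - s) * (1 - s * ρ) := mul_nonneg (by positivity) (by nlinarith)
  have h1 := lintegral_map (μ := multivariateGaussian 0 (spiked M s w))
    (f := fun u : ℝ => ENNReal.ofReal
      ((√(1 - s))⁻¹ * Real.exp (-(s / (1 - s) / M) * u ^ 2 / 2)))
    (g := fun x => inner ℝ v x) (by fun_prop) (by fun_prop)
  refine h1.symm.trans ?_
  rw [map_inner_spiked hM hs0 hs1 hw, lintegral_map (by fun_prop) (by fun_prop), hv,
    real_inner_comm v w, one_pow]
  have h2 : ∀ h : ℝ, (√(1 - s))⁻¹ * Real.exp (-(s / (1 - s) / M) *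
      (√(M * (1 - s * ρ)) * h) ^ 2 / 2) = (√(1 - s))⁻¹ *
        Real.exp (0 * h - (s / (1 - s) * (1 - s * ρ)) * h ^ 2 / 2) := by
    intro h
    rw [mul_pow, Real.sq_sqrt hσ]
    congr 2
    field_simp
    ring
  refine (lintegral_congr fun h => congrArg ENNReal.ofReal (h2 h)).trans ?_
  rw [← ofReal_integral_eq_lintegral_ofReal
    ((integrable_exp_quadratic_gaussianReal 0 (by linarith)).const_mul _)
    (ae_of_all _ fun _ => by positivity), integral_const_mul,
    integral_exp_quadratic_gaussianReal 0 (by linarith)]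
  congr 1
  simp only [ne_eq, OfNat.ofNat_ne_zero, not_false_eq_true, zero_pow, zero_div, Real.exp_zero,
    mul_one]
  rw [← mul_inv, ← Real.sqrt_mul hs.le]
  congr 2
  field_simp
  ring

/-- Characteristic functions are compared, without Lebesgue densities. The factor `exp (-β² ⟨v, x⟩²
/ 2)` is itself the characteristic function of `N(0, 1)` at `β ⟨v, x⟩`; after Fubini there remains a
one-dimensional Gaussian average of the characteristic function of `N(0, M I)` at `t + β h v`. -/
theorem multivariateGaussian_spiked_eq_withDensity (hM : 0 < M) (hs0 : 0 ≤ s) (hs1 : s < 1)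
    (hv : ‖v‖ = 1) :
    multivariateGaussian 0 (spiked M s v) =
      (multivariateGaussian 0 (spiked M 0 v)).withDensity
        fun x => ENNReal.ofReal (spikedDensity M s v x) := by
  have hs : 0 < 1 - s := by linarith
  set μ := multivariateGaussian 0 (spiked M 0 v) with hμ
  have hfin : ∫⁻ x, ENNReal.ofReal (spikedDensity M s v x) ∂μ ≠ ∞ := by
    refine ne_top_of_le_ne_top (b := ENNReal.ofReal (√(1 - s))⁻¹) ENNReal.ofReal_ne_top ?_
    calc _ ≤ ∫⁻ x, ENNReal.ofReal (√(1 - s))⁻¹ ∂μ := by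
          refine lintegral_mono fun x => ENNReal.ofReal_le_ofReal ?_
          refine mul_le_of_le_one_right (by positivity) (Real.exp_le_one_iff.2 ?_)
          have : 0 ≤ s / (1 - s) / M * inner ℝ v x ^ 2 := by positivity
          linarith
      _ = _ := by simp
  have := isFiniteMeasure_withDensity hfin
  refine Measure.ext_of_charFun ?_
  ext t
  rw [charFun_spiked hM hs0 hs1 hv, charFun_apply, integral_withDensity_eq_integral_toReal_smul
    (measurable_spikedDensity M s v).ennreal_ofReal (by simp)]
  set β : ℝ := √(s / (1 - s) / M) with hβ
  have hβ2 : β ^ 2 = s / (1 - s) / M := Real.sq_sqrt (by positivity)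
  have h1 : ∀ x, (ENNReal.ofReal (spikedDensity M s v x)).toReal •
      Complex.exp (inner ℝ x t * Complex.I) = ((√(1 - s))⁻¹ : ℝ) *
        ∫ h, Complex.exp ((inner ℝ x (t + (β * h) • v) : ℝ) * Complex.I)
          ∂(gaussianReal 0 1) := by
    intro x
    rw [ENNReal.toReal_ofReal (spikedDensity_nonneg M s v x)]
    have h2 := charFun_gaussianReal (μ := 0) (v := 1) (β * inner ℝ v x)
    rw [charFun_apply_real] at h2
    simp_rw [inner_add_right, real_inner_smul_right, Complex.ofReal_add, add_mul, Complex.exp_add]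
    rw [integral_const_mul]
    have h3 : ∀ h : ℝ, ((β * h * inner ℝ x v : ℝ) : ℂ) * Complex.I =
        ((β * inner ℝ v x : ℝ) : ℂ) * (h : ℂ) * Complex.I := by
      intro h; rw [real_inner_comm]; push_cast; ring
    simp_rw [h3]
    rw [h2, spikedDensity, ← hβ2]
    simp only [Complex.real_smul]
    push_cast
    -- The factors `0` and `1` are the mean and variance in `charFun_gaussianReal`.
    rw [show (-(β : ℂ) ^ 2 * (inner ℝ v x : ℝ) ^ 2 / 2) =
      (β * (inner ℝ v x : ℝ) * 0 * Complex.I - 1 * (β * (inner ℝ v x : ℝ)) ^ 2 / 2) by ring]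
    ring
  simp_rw [h1]
  rw [integral_const_mul, integral_integral_swap]
  · have h4 : ∀ h : ℝ, ∫ x, Complex.exp ((inner ℝ x (t + (β * h) • v) : ℝ) * Complex.I) ∂μ =
        ((Real.exp (-(M * ‖t‖ ^ 2 / 2)) * Real.exp ((-(M * β * inner ℝ v t)) * h -
          (M * β ^ 2) * h ^ 2 / 2) : ℝ) : ℂ) := by
      intro h
      rw [← charFun_apply, hμ, charFun_spiked hM le_rfl one_pos hv, ← Real.exp_add]
      congr 2
      rw [norm_add_sq_real, norm_smul, real_inner_smul_right, hv, real_inner_comm, mul_one,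
        Real.norm_eq_abs, sq_abs]
      ring
    simp_rw [h4]
    rw [integral_complex_ofReal, integral_const_mul,
      integral_exp_quadratic_gaussianReal _ (by have : 0 ≤ M * β ^ 2 := (by positivity); linarith)]
    norm_cast
    -- Hence the square root from the Gaussian integral cancels the normalisation of the density.
    have h5 : 1 + M * β ^ 2 = (1 - s)⁻¹ := by
      rw [hβ2]; field_simp; ring
    rw [h5, Real.sqrt_inv, inv_inv, mul_left_comm (Real.exp _), ← mul_assoc,
      inv_mul_cancel₀ (by positivity), one_mul, ← Real.exp_add]
    congr 1
    have : (-(M * β * inner ℝ v t)) ^ 2 = M * (M * β ^ 2) * inner ℝ v t ^ 2 := by ring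
    rw [this, hβ2]
    field_simp
    ring
  · refine (integrable_const (1 : ℝ)).mono' (by fun_prop) (ae_of_all _ fun q => ?_)
    simp only [Function.uncurry]
    rw [Complex.norm_exp_ofReal_mul_I]

/-! ### Le Cam's two-point method with a mixture. -/

/-- For `a ≥ 1` this is `(a / 2 - 1)² ≥ 0`. It turns a second moment bound on a likelihood ratio
into a lower bound on the overlap of the two laws. -/
theorem ennreal_le_min_one_add (a : ℝ≥0∞) : a ≤ min 1 a + a ^ 2 / 4 := by
  rcases le_total a 1 with h | h
  · rw [min_eq_right h]; exact le_self_add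
  · rw [min_eq_left h]
    rcases eq_or_ne a ∞ with rfl | ha
    · simp [ENNReal.top_div]
    · lift a to NNReal using ha
      have : (1 + (a : ℝ≥0∞) ^ 2 / 4) = ((1 + a ^ 2 / 4 : NNReal) : ℝ≥0∞) := by
        rw [ENNReal.coe_add, ENNReal.coe_div (by norm_num)]
        push_cast
        rfl
      rw [this, ENNReal.coe_le_coe, ← NNReal.coe_le_coe]
      push_cast
      nlinarith [sq_nonneg ((a : ℝ) / 2 - 1)]

/-- Le Cam's bound for testing a point against a finite mixture, in terms of the second moment
of the likelihood ratio of the mixture. -/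
theorem half_le_lintegral_add_sum {ι Ω : Type*} [Fintype ι] [Nonempty ι] [MeasurableSpace Ω]
    (μ : Measure Ω) {g L : ι → Ω → ℝ≥0∞} {L₀ : Ω → ℝ≥0∞} {D : ℝ≥0∞}
    (hg : ∀ i, Measurable (g i)) (hL₀ : Measurable L₀) (hL : ∀ i, Measurable (L i))
    (hg1 : ∀ i, ∫⁻ x, g i x ∂μ = 1) (hsep : ∀ i x, D ≤ L₀ x + L i x)
    (hchi : ∑ i, ∑ j, ∫⁻ x, g i x * g j x ∂μ ≤ 2 * (Fintype.card ι : ℝ≥0∞) ^ 2) :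
    D / 2 ≤ ∫⁻ x, L₀ x ∂μ +
      (Fintype.card ι : ℝ≥0∞)⁻¹ * ∑ i, ∫⁻ x, L i x ∂(μ.withDensity (g i)) := by
  set N : ℝ≥0∞ := (Fintype.card ι : ℝ≥0∞) with hN
  have hN0 : N ≠ 0 := by simp [hN]
  have hNt : N ≠ ∞ := ENNReal.natCast_ne_top _
  set G : Ω → ℝ≥0∞ := fun x => N⁻¹ * ∑ i, g i x with hG
  have hGm : Measurable G := (Finset.measurable_sum _ fun i _ => hg i).const_mul _
  have hG1 : ∫⁻ x, G x ∂μ = 1 := by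
    rw [lintegral_const_mul _ (Finset.measurable_sum _ fun i _ => hg i),
      lintegral_finsetSum _ fun i _ => hg i]
    simp [hg1, ← hN, ENNReal.inv_mul_cancel hN0 hNt]
  have hG2 : ∫⁻ x, G x ^ 2 / 4 ∂μ ≤ 1 / 2 := by
    have h1 : ∀ x, G x ^ 2 / 4 = (N⁻¹ ^ 2 * 4⁻¹) * ∑ i, ∑ j, g i x * g j x := by
      intro x
      rw [hG, ENNReal.div_eq_inv_mul, mul_pow, sq (∑ i, g i x), Finset.sum_mul_sum]
      ring
    simp_rw [h1]
    rw [lintegral_const_mul _ (by fun_prop), lintegral_finsetSum _ (by fun_prop)]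
    have h2 : ∀ i, ∫⁻ x, ∑ j, g i x * g j x ∂μ = ∑ j, ∫⁻ x, g i x * g j x ∂μ := fun i =>
      lintegral_finsetSum _ fun j _ => (hg i).mul (hg j)
    simp_rw [h2]
    calc _ ≤ N⁻¹ ^ 2 * 4⁻¹ * (2 * N ^ 2) := by gcongr
      _ = (N⁻¹ * N) ^ 2 * (4⁻¹ * 2) := by ring
      _ = 4⁻¹ * 2 := by rw [ENNReal.inv_mul_cancel hN0 hNt]; simp
      _ = 1 / 2 := by
        rw [show (4 : ℝ≥0∞) = 2 * 2 by norm_num, ENNReal.mul_inv (by simp) (by simp), mul_assoc,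
          ENNReal.inv_mul_cancel (by simp) (by simp), mul_one, one_div]
  -- The mixture likelihood ratio `G` has mean 1 and second moment at most 2, so the overlap is at
  -- least `1 - 2 / 4`.
  have hmin : 1 / 2 ≤ ∫⁻ x, min 1 (G x) ∂μ := by
    have h2 : (1 : ℝ≥0∞) ≤ ∫⁻ x, min 1 (G x) ∂μ + 1 / 2 := by
      calc (1 : ℝ≥0∞) = ∫⁻ x, G x ∂μ := hG1.symm
        _ ≤ ∫⁻ x, (min 1 (G x) + G x ^ 2 / 4) ∂μ :=
          lintegral_mono fun x => ennreal_le_min_one_add _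
        _ = ∫⁻ x, min 1 (G x) ∂μ + ∫⁻ x, G x ^ 2 / 4 ∂μ :=
          lintegral_add_left (measurable_const.min hGm) _
        _ ≤ _ := by gcongr
    have h3 : (1 : ℝ≥0∞) / 2 + 1 / 2 ≤ ∫⁻ x, min 1 (G x) ∂μ + 1 / 2 := by
      rwa [ENNReal.add_halves]
    exact (ENNReal.add_le_add_iff_right (by simp)).1 h3
  calc D / 2 = D * (1 / 2) := by rw [one_div, ENNReal.div_eq_inv_mul, mul_comm]
    _ ≤ D * ∫⁻ x, min 1 (G x) ∂μ := by gcongr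
    _ = ∫⁻ x, D * min 1 (G x) ∂μ := (lintegral_const_mul _ (measurable_const.min hGm)).symm
    _ ≤ ∫⁻ x, (L₀ x + N⁻¹ * ∑ i, g i x * L i x) ∂μ := by
      refine lintegral_mono fun x => ?_
      -- Truncated subtraction: whatever `L₀` lacks to reach `D` is supplied by every `L i`.
      have h4 : (D - L₀ x) * G x ≤ N⁻¹ * ∑ i, g i x * L i x := by
        rw [hG, mul_left_comm, Finset.mul_sum]
        refine mul_le_mul_right (Finset.sum_le_sum fun i _ => ?_) _
        rw [mul_comm]
        refine mul_le_mul_right ?_ _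
        exact tsub_le_iff_left.2 (hsep i x)
      calc D * min 1 (G x) ≤ (L₀ x + (D - L₀ x)) * min 1 (G x) := by
            gcongr; exact le_add_tsub
        _ ≤ L₀ x * 1 + (D - L₀ x) * G x := by
            rw [add_mul]
            gcongr
            · exact min_le_left _ _
            · exact min_le_right _ _
        _ ≤ _ := by rw [mul_one]; gcongr
    _ = _ := by
      rw [lintegral_add_left hL₀, lintegral_const_mul _ (by fun_prop),
        lintegral_finsetSum _ (by fun_prop)]
      congr 3
      ext i
      rw [lintegral_withDensity_eq_lintegral_mul _ (hg i) (hL i)]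
      rfl

/-! ### Separation of the losses and membership in the banded class. -/

theorem specNorm_add_le {p : ℕ} (A B : Matrix (Fin p) (Fin p) ℝ) :
    specNorm (A + B) ≤ specNorm A + specNorm B := by
  unfold specNorm; rw [map_add]; exact norm_add_le _ _

theorem specNorm_neg {p : ℕ} (A : Matrix (Fin p) (Fin p) ℝ) : specNorm (-A) = specNorm A := by
  unfold specNorm; rw [map_neg, norm_neg]

theorem measurable_specNorm (p : ℕ) :
    Measurable (specNorm : Matrix (Fin p) (Fin p) ℝ → ℝ) := by
  have : Continuous (Matrix.toEuclideanCLM (𝕜 := ℝ) (n := Fin p)) :=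
    LinearMap.continuous_of_finiteDimensional
      (Matrix.toEuclideanCLM (𝕜 := ℝ) (n := Fin p)).toAlgEquiv.toLinearMap
  exact this.norm.measurable

theorem measurable_pLoss {n p : ℕ} (d : Procedure p) (S₀ : PosDefMatrix p) :
    Measurable (pLoss (n := n) d S₀) := by
  unfold pLoss
  refine Measurable.lintegral_kernel (ENNReal.measurable_ofReal.comp (Measurable.pow_const ?_ _))
  refine (measurable_specNorm p).comp ?_
  exact d.measurable_post.sub_const _

theorem specNorm_sq_div_two_le_pLoss_add {n p : ℕ} (d : Procedure p) (S T : PosDefMatrix p)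
    (x : Sample n p) :
    ENNReal.ofReal (specNorm (S.1 - T.1) ^ 2 / 2) ≤ pLoss d S x + pLoss d T x := by
  unfold pLoss
  set κ := posterior (model n p) (d.prior : Measure (PosDefMatrix p)) x
  have hm : Measurable fun R => ENNReal.ofReal (specNorm (d.post R - S.1) ^ 2) := by
    refine ENNReal.measurable_ofReal.comp (Measurable.pow_const ?_ _)
    exact (measurable_specNorm p).comp (d.measurable_post.sub_const _)
  rw [← lintegral_add_left hm]
  calc _ = ∫⁻ _, ENNReal.ofReal (specNorm (S.1 - T.1) ^ 2 / 2) ∂κ := by simp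
    _ ≤ _ := by
      refine lintegral_mono fun R => ?_
      rw [← ENNReal.ofReal_add (by positivity) (by positivity)]
      refine ENNReal.ofReal_le_ofReal ?_
      have h := specNorm_add_le (-(d.post R - S.1)) (d.post R - T.1)
      rw [specNorm_neg, show -(d.post R - S.1) + (d.post R - T.1) = S.1 - T.1 by abel] at h
      have h0 : 0 ≤ specNorm (S.1 - T.1) := norm_nonneg _
      nlinarith [sq_nonneg (specNorm (d.post R - S.1) - specNorm (d.post R - T.1))]

theorem le_specNorm_spiked_sub (hM : 0 < M) (hs0 : 0 ≤ s) (hv : ‖v‖ = 1) :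
    M * s ≤ specNorm (spiked M 0 v - spiked M s v) := by
  have h := (Matrix.toEuclideanCLM (𝕜 := ℝ) (spiked M 0 v - spiked M s v)).le_opNorm v
  have h2 : Matrix.toEuclideanCLM (𝕜 := ℝ) (spiked M 0 v - spiked M s v) v = (M * s) • v := by
    ext i
    have h3 : (Matrix.toEuclideanCLM (𝕜 := ℝ) (spiked M 0 v - spiked M s v) v) i =
      ((spiked M 0 v - spiked M s v).mulVec v) i := rfl
    rw [h3, Matrix.sub_mulVec, spiked_mulVec, spiked_mulVec, real_inner_self_eq_norm_sq, hv]
    simp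
    ring
  rw [h2, norm_smul, hv, mul_one, mul_one, Real.norm_of_nonneg (by positivity)] at h
  exact h

theorem spiked_zero (M : ℝ) (v w : EuclideanSpace ℝ (Fin p)) : spiked M 0 v = spiked M 0 w := by
  simp [spiked]

/-- At a unit eigenvector `e` the eigenvalue is the Rayleigh quotient `M (1 - s ⟨v, e⟩²)`, which
lies in `[M (1 - s), M]`. The spike points downwards, so the upper bound `M` costs nothing. -/
theorem spiked_mem_bandedClass {k : ℕ} {M₁ : ℝ} (hM : 0 < M) (hs0 : 0 ≤ s) (hs1 : s < 1)
    (hM₁ : M₁ ≤ M * (1 - s)) (hv : ‖v‖ = 1)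
    (hband : ∀ i j : Fin p, (k : ℤ) < |(i : ℤ) - (j : ℤ)| → v i * v j = 0) :
    (⟨spiked M s v, spiked_posDef hM hs0 hs1 hv⟩ : PosDefMatrix p) ∈ bandedClass p k M M₁ := by
  refine ⟨fun i j hij => ?_, fun i => ?_⟩
  · have hne : i ≠ j := by
      rintro rfl
      simp at hij
      omega
    simp [spiked, hne, Matrix.vecMulVec_apply, hband i j hij]
  · rw [Matrix.IsHermitian.eigenvalues_eq]
    set e := (spiked_posDef hM hs0 hs1 hv).isHermitian.eigenvectorBasis i with he
    have he1 : ‖e‖ = 1 :=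
      (spiked_posDef hM hs0 hs1 hv).isHermitian.eigenvectorBasis.orthonormal.1 i
    have h := dotProduct_spiked_mulVec M s v e
    simp only [star_trivial, RCLike.re_to_real]
    rw [h, he1]
    have h1 : |inner ℝ v e| ≤ 1 := by simpa [hv, he1] using abs_real_inner_le_norm v e
    have h2 : inner ℝ v e ^ 2 ≤ 1 := by rw [← sq_abs]; exact pow_le_one₀ (abs_nonneg _) h1
    have h3 : s * inner ℝ v e ^ 2 ≤ s * 1 := by gcongr
    have h4 : 0 ≤ s * inner ℝ v e ^ 2 := by positivity
    constructor
    · nlinarith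
    · nlinarith

/-- For `0 ≤ u ≤ 1 / 2`, `(1 - u) (1 + 2 u) ≥ 1`, and `1 + 2 u ≤ exp (2 u)`. -/
theorem inv_sqrt_one_sub_le_exp {u : ℝ} (h0 : 0 ≤ u) (h1 : u ≤ 1 / 2) :
    (√(1 - u))⁻¹ ≤ Real.exp u := by
  have h2 : 0 < 1 - u := by linarith
  have h3 : Real.exp (-u) ≤ √(1 - u) := by
    refine Real.le_sqrt_of_sq_le ?_
    rw [← Real.exp_nat_mul]
    have h4 : 2 * u + 1 ≤ Real.exp (2 * u) := Real.add_one_le_exp _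
    have h5 : Real.exp (((2 : ℕ) : ℝ) * -u) = (Real.exp (2 * u))⁻¹ := by
      rw [← Real.exp_neg]; push_cast; ring_nf
    rw [h5]
    refine inv_le_of_inv_le₀ h2 (le_trans ?_ h4)
    rw [inv_le_iff_one_le_mul₀ h2]
    nlinarith
  rw [← neg_neg u, Real.exp_neg, neg_neg]
  gcongr

/-! ### Reduction of the minimax risk to an exponential moment. -/

/-- Lower bound on the minimax risk from a finite family of rank-one perturbations of `M₀ I`. -/
theorem ofReal_le_minimaxRisk {n p k : ℕ} {M₀ M₁ s : ℝ} {ι : Type*} [Fintype ι] [Nonempty ι]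
    (v : ι → EuclideanSpace ℝ (Fin p)) (hM₀ : 0 < M₀) (hs0 : 0 ≤ s) (hs2 : s ^ 2 ≤ 1 / 2)
    (hM₁ : M₁ ≤ M₀ * (1 - s)) (hv : ∀ a, ‖v a‖ = 1)
    (hband : ∀ a, ∀ i j : Fin p, (k : ℤ) < |(i : ℤ) - (j : ℤ)| → v a i * v a j = 0)
    (hchi : ∑ a, ∑ b, Real.exp (n * s ^ 2 * inner ℝ (v a) (v b) ^ 2) ≤
      2 * (Fintype.card ι : ℝ) ^ 2) :
    ENNReal.ofReal (M₀ ^ 2 * s ^ 2 / 8) ≤ minimaxRisk n p k M₀ M₁ := by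
  have hs1 : s < 1 := by nlinarith
  refine le_iInf fun d => ?_
  set R := ⨆ S₀ ∈ bandedClass p k M₀ M₁, pRisk n d S₀ with hR
  obtain ⟨a₀⟩ := ‹Nonempty ι›
  have : Nonempty ι := ⟨a₀⟩
  set S : ι → PosDefMatrix p := fun a => ⟨spiked M₀ s (v a), spiked_posDef hM₀ hs0 hs1 (hv a)⟩
  -- The null covariance `M₀ I`; the direction `v a₀` is immaterial when `s = 0`.
  set S₀ : PosDefMatrix p :=
    ⟨spiked M₀ 0 (v a₀), spiked_posDef hM₀ le_rfl one_pos (hv a₀)⟩ with hS₀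
  have hSle : ∀ a, pRisk n d (S a) ≤ R := fun a => le_iSup₂_of_le (S a)
    (spiked_mem_bandedClass hM₀ hs0 hs1 hM₁ (hv a) (hband a)) le_rfl
  have hS₀le : pRisk n d S₀ ≤ R := le_iSup₂_of_le S₀
    (spiked_mem_bandedClass hM₀ le_rfl one_pos (hM₁.trans (by nlinarith)) (hv a₀) (hband a₀)) le_rfl
  set f : ι → EuclideanSpace ℝ (Fin p) → ℝ≥0∞ :=
    fun a x => ENNReal.ofReal (spikedDensity M₀ s (v a) x) with hf
  have hfm : ∀ a, Measurable (f a) := fun a => (measurable_spikedDensity _ _ _).ennreal_ofReal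
  set g : ι → Sample n p → ℝ≥0∞ := fun a x => ∏ i, f a (x i) with hg
  have hgm : ∀ a, Measurable (g a) := fun a => by
    have := hfm a
    fun_prop
  have hdens1 : ∀ a, multivariateGaussian 0 (S a).1 =
      (multivariateGaussian 0 S₀.1).withDensity (f a) := by
    intro a
    have := multivariateGaussian_spiked_eq_withDensity hM₀ hs0 hs1 (hv a)
    rwa [spiked_zero M₀ (v a) (v a₀)] at this
  have hdens : ∀ a, sampleLaw n (S a) = (sampleLaw n S₀).withDensity (g a) := by
    intro a
    have : IsProbabilityMeasure ((multivariateGaussian 0 S₀.1).withDensity (f a)) := by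
      rw [← hdens1]; infer_instance
    simp only [sampleLaw, hdens1]
    exact pi_withDensity _ (hfm a)
  have hprob : ∀ T : PosDefMatrix p, IsProbabilityMeasure (sampleLaw n T) := fun T => by
    unfold sampleLaw; infer_instance
  have hg1 : ∀ a, ∫⁻ x, g a x ∂(sampleLaw n S₀) = 1 := by
    intro a
    have := (hprob (S a)).measure_univ
    rwa [hdens, withDensity_apply _ MeasurableSet.univ, Measure.restrict_univ] at this
  have hcross : ∀ a b, ∫⁻ x, g a x * g b x ∂(sampleLaw n S₀) ≤
      ENNReal.ofReal (Real.exp (n * s ^ 2 * inner ℝ (v a) (v b) ^ 2)) := by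
    intro a b
    have h1 : ∫⁻ x, g a x * g b x ∂(sampleLaw n S₀) = ∫⁻ x, g a x ∂(sampleLaw n (S b)) := by
      rw [hdens, lintegral_withDensity_eq_lintegral_mul _ (hgm b) (hgm a)]
      exact lintegral_congr fun x => mul_comm _ _
    have hρ : inner ℝ (v a) (v b) ^ 2 ≤ 1 := by
      have := abs_real_inner_le_norm (v a) (v b)
      rw [hv, hv, mul_one] at this
      rw [← sq_abs]
      exact pow_le_one₀ (abs_nonneg _) this
    rw [h1, sampleLaw, lintegral_pi_prod _ fun _ => hfm a, Finset.prod_const, Finset.card_univ,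
      Fintype.card_fin, lintegral_spikedDensity_spiked hM₀ hs0 hs1 (hv a) (hv b),
      ← ENNReal.ofReal_pow (by positivity)]
    refine ENNReal.ofReal_le_ofReal ?_
    rw [mul_assoc, Real.exp_nat_mul]
    gcongr
    exact inv_sqrt_one_sub_le_exp (by positivity)
      ((mul_le_of_le_one_right (by positivity) hρ).trans hs2)
  have hsep : ∀ a x, ENNReal.ofReal (M₀ ^ 2 * s ^ 2 / 2) ≤
      pLoss d S₀ x + pLoss (n := n) d (S a) x := by
    intro a x
    refine le_trans (ENNReal.ofReal_le_ofReal ?_) (specNorm_sq_div_two_le_pLoss_add d S₀ (S a) x)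
    have h := le_specNorm_spiked_sub hM₀ hs0 (hv a)
    rw [spiked_zero M₀ (v a) (v a₀)] at h
    rw [← mul_pow]
    gcongr
  have key := half_le_lintegral_add_sum (sampleLaw n S₀) hgm
    (measurable_pLoss d S₀) (fun a => measurable_pLoss d (S a)) hg1 hsep (by
      calc _ ≤ ∑ a, ∑ b, ENNReal.ofReal (Real.exp (n * s ^ 2 * inner ℝ (v a) (v b) ^ 2)) := by
            gcongr with a _ b _
            exact hcross a b
        _ = ENNReal.ofReal (∑ a, ∑ b, Real.exp (n * s ^ 2 * inner ℝ (v a) (v b) ^ 2)) := by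
            rw [ENNReal.ofReal_sum_of_nonneg fun a _ => by positivity]
            refine Finset.sum_congr rfl fun a _ => ?_
            rw [ENNReal.ofReal_sum_of_nonneg fun b _ => by positivity]
        _ ≤ ENNReal.ofReal (2 * (Fintype.card ι : ℝ) ^ 2) := ENNReal.ofReal_le_ofReal hchi
        _ = _ := by
            rw [ENNReal.ofReal_mul (by norm_num), ENNReal.ofReal_pow (by positivity)]
            simp)
  simp_rw [← hdens] at key
  -- The worst-case risk `R` bounds both the risk at the null and the average risk over the mixture.
  have key2 : ENNReal.ofReal (M₀ ^ 2 * s ^ 2 / 2) / 2 ≤ 2 * R := by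
    refine key.trans ?_
    calc _ ≤ R + (Fintype.card ι : ℝ≥0∞)⁻¹ * ∑ _a : ι, R := by
          gcongr with a
          · exact hS₀le
          · exact hSle a
      _ = 2 * R := by
          rw [Finset.sum_const, Finset.card_univ, nsmul_eq_mul, ← mul_assoc,
            ENNReal.inv_mul_cancel (by simp) (ENNReal.natCast_ne_top _), one_mul, two_mul]
  have h8 : ENNReal.ofReal (M₀ ^ 2 * s ^ 2 / 8) = ENNReal.ofReal (M₀ ^ 2 * s ^ 2 / 2) / 2 / 2 := by
    rw [← ENNReal.ofReal_ofNat 2, ← ENNReal.ofReal_div_of_pos (by norm_num),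
      ← ENNReal.ofReal_div_of_pos (by norm_num)]
    congr 1
    ring
  rw [h8]
  exact ENNReal.div_le_of_le_mul' key2

/-! ### Rademacher sums and sign vectors. -/

/-- The sum factorises over coordinates into terms `2 cosh (a ε i)`, and `cosh x ≤ exp (x² / 2)`. -/
theorem sum_exp_signed_sum_le (k : ℕ) (a : ℝ) (ε : Fin k → ℝ) (hε : ∀ i, ε i ^ 2 = 1) :
    ∑ δ : Fin k → Bool, Real.exp (a * ∑ i, ε i * (if δ i then 1 else -1)) ≤
      2 ^ k * Real.exp (k * (a ^ 2 / 2)) := by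
  have h1 : ∀ δ : Fin k → Bool, Real.exp (a * ∑ i, ε i * (if δ i then 1 else -1)) =
      ∏ i, Real.exp (a * ε i * (if δ i then 1 else -1)) := by
    intro δ
    rw [← Real.exp_sum, Finset.mul_sum]
    simp_rw [mul_assoc]
  simp_rw [h1]
  rw [← Fintype.piFinset_univ, ← Finset.prod_univ_sum (fun _ => (Finset.univ : Finset Bool))
    (fun i (b : Bool) => Real.exp (a * ε i * (if b then 1 else -1)))]
  have h2 : ∀ i, ∑ b : Bool, Real.exp (a * ε i * (if b then 1 else -1)) ≤
      2 * Real.exp (a ^ 2 / 2) := by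
    intro i
    have h3 := Real.cosh_le_exp_half_sq (a * ε i)
    rw [mul_pow, hε, mul_one, Real.cosh_eq] at h3
    simp only [Fintype.sum_bool, if_true, Bool.false_eq_true, if_false, mul_one, mul_neg]
    linarith
  calc _ ≤ ∏ _i : Fin k, 2 * Real.exp (a ^ 2 / 2) :=
        Finset.prod_le_prod (fun i _ => by positivity) fun i _ => h2 i
    _ = _ := by
      rw [Finset.prod_const, Finset.card_univ, Fintype.card_fin, mul_pow, Real.exp_nat_mul]

/-- The exponential moment of the square of a normalised Rademacher sum. -/
theorem sum_exp_sq_signed_sum_le {k : ℕ} (hk : k ≠ 0) {c : ℝ} (hc0 : 0 ≤ c) (hc : c ≤ 3 / 8)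
    (ε : Fin k → ℝ) (hε : ∀ i, ε i ^ 2 = 1) :
    ∑ δ : Fin k → Bool, Real.exp (c * (∑ i, ε i * (if δ i then 1 else -1)) ^ 2 / k) ≤
      2 * 2 ^ k := by
  have hk' : (0 : ℝ) < k := by positivity
  set S : (Fin k → Bool) → ℝ := fun δ => ∑ i, ε i * (if δ i then 1 else -1) with hS
  -- The square is linearised by an auxiliary standard Gaussian `h`: `exp (c S² / k)` is the mean of
  -- `exp (β S h)`, to which the sub-Gaussian bound applies for each fixed `h`.
  set β : ℝ := √(2 * c / k) with hβ
  have hβ2 : β ^ 2 = 2 * c / k := Real.sq_sqrt (by positivity)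
  have h1 : ∀ δ, Real.exp (c * S δ ^ 2 / k) =
      ∫ h, Real.exp (β * S δ * h) ∂(gaussianReal 0 1) := by
    intro δ
    have := integral_exp_quadratic_gaussianReal (β * S δ) (b := 0) (by norm_num)
    simp only [zero_mul, zero_div, sub_zero, add_zero, Real.sqrt_one, inv_one, one_mul,
      mul_one] at this
    rw [this, mul_pow, hβ2]
    congr 1
    field_simp
  have h2 : ∀ δ, Integrable (fun h => Real.exp (β * S δ * h)) (gaussianReal 0 1) := by
    intro δ
    simpa using integrable_exp_quadratic_gaussianReal (β * S δ) (b := 0) (by norm_num)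
  have hb : -1 < -(2 * c) := by linarith
  have h3 := integral_exp_quadratic_gaussianReal 0 hb
  have h4 := integrable_exp_quadratic_gaussianReal 0 hb
  change ∑ δ, Real.exp (c * S δ ^ 2 / k) ≤ _
  simp_rw [h1]
  rw [← integral_finsetSum _ fun δ _ => h2 δ]
  calc ∫ h, ∑ δ, Real.exp (β * S δ * h) ∂(gaussianReal 0 1)
      ≤ ∫ h, 2 ^ k * Real.exp (0 * h - -(2 * c) * h ^ 2 / 2) ∂(gaussianReal 0 1) := by
        refine integral_mono (integrable_finsetSum _ fun δ _ => h2 δ) (h4.const_mul _) fun h => ?_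
        have h5 := sum_exp_signed_sum_le k (β * h) ε hε
        have h6 : (k : ℝ) * ((β * h) ^ 2 / 2) = 0 * h - -(2 * c) * h ^ 2 / 2 := by
          rw [mul_pow, hβ2]; field_simp; ring
        rw [h6] at h5
        refine le_trans (le_of_eq ?_) h5
        refine Finset.sum_congr rfl fun δ _ => ?_
        rw [mul_right_comm]
    _ = 2 ^ k * (√(1 + -(2 * c)))⁻¹ := by rw [integral_const_mul, h3]; simp
    _ ≤ 2 ^ k * 2 := by
        gcongr
        -- This is where `3 / 8` comes from: `(1 - 2 c)^(-1/2) ≤ 2` exactly when `c ≤ 3 / 8`.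
        rw [inv_le_comm₀ (Real.sqrt_pos.2 (by linarith)) two_pos]
        refine Real.le_sqrt_of_sq_le ?_
        norm_num
        linarith
    _ = _ := mul_comm _ _

/-- The normalised sign vector on the first `k` coordinates. -/
noncomputable def signVector (p k : ℕ) (ε : Fin k → Bool) : EuclideanSpace ℝ (Fin p) :=
  WithLp.toLp 2 fun i => if h : (i : ℕ) < k then (if ε ⟨i, h⟩ then 1 else -1) / √k else 0

theorem inner_signVector {p k : ℕ} (hkp : k ≤ p) (ε δ : Fin k → Bool) :
    inner ℝ (signVector p k ε) (signVector p k δ) =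
      (∑ i, (if ε i then 1 else -1) * (if δ i then 1 else -1)) / (k : ℝ) := by
  obtain ⟨m, rfl⟩ := Nat.exists_eq_add_of_le hkp
  simp only [PiLp.inner_apply, Fin.sum_univ_add]
  simp only [signVector, RCLike.inner_apply, conj_trivial, Fin.val_castAdd, Fin.is_lt, dite_true,
    Fin.eta, Fin.val_natAdd]
  rw [Finset.sum_div]
  simp only [add_lt_iff_neg_left, not_lt_zero, dite_false, mul_zero, Finset.sum_const_zero,
    add_zero]
  refine Finset.sum_congr rfl fun i _ => ?_
  rw [div_mul_div_comm, Real.mul_self_sqrt (by positivity), mul_comm]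

theorem norm_signVector {p k : ℕ} (hk : k ≠ 0) (hkp : k ≤ p) (ε : Fin k → Bool) :
    ‖signVector p k ε‖ = 1 := by
  have h := inner_signVector hkp ε ε
  rw [real_inner_self_eq_norm_sq] at h
  have h1 : ∀ i, (if ε i then (1 : ℝ) else -1) * (if ε i then 1 else -1) = 1 := by
    intro i; split_ifs <;> norm_num
  simp_rw [h1] at h
  have hk' : (k : ℝ) ≠ 0 := by positivity
  simp only [Finset.sum_const, Finset.card_univ, Fintype.card_fin, nsmul_eq_mul, mul_one,
    div_self hk'] at h
  exact (pow_eq_one_iff_of_nonneg (norm_nonneg _) two_ne_zero).1 h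

/-! ### The two lower bounds and their combination. -/

/-- Sign vectors are used with `s² = c k / n`, so `n s² ⟨v, w⟩²` is `c / k` times a squared
Rademacher sum. The cap `3 / 8` on `c` controls its exponential moment; the other cap keeps the
eigenvalues above `M₁`. -/
theorem bandwidth_le_minimaxRisk {n p k : ℕ} {M₀ M₁ : ℝ} (hM₁ : 0 < M₁)
    (hM : M₁ < M₀) (hn : 1 ≤ n) (hkp : k ≤ p)
    (hkn : (k : ℝ) ≤ n / 2) :
    ENNReal.ofReal (M₀ ^ 2 * min (3 / 8) ((1 - M₁ / M₀) ^ 2) / 8 * (k / n)) ≤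
      minimaxRisk n p k M₀ M₁ := by
  have hM₀ : 0 < M₀ := hM₁.trans hM
  rcases eq_or_ne k 0 with rfl | hk
  · simp
  have hk' : (0 : ℝ) < k := by positivity
  have hn' : (0 : ℝ) < n := by exact_mod_cast hn
  set c : ℝ := min (3 / 8) ((1 - M₁ / M₀) ^ 2)
  have hr : 0 ≤ 1 - M₁ / M₀ := by rw [sub_nonneg, div_le_one hM₀]; exact hM.le
  have hc0 : 0 ≤ c := by positivity
  have hc1 : c ≤ 3 / 8 := min_le_left _ _
  have hc2 : c ≤ (1 - M₁ / M₀) ^ 2 := min_le_right _ _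
  have hkn' : (k : ℝ) / n ≤ 1 / 2 := by rw [div_le_iff₀ hn']; linarith
  have hkn0 : (0 : ℝ) ≤ k / n := by positivity
  have hs2 : √(c * (k / n)) ^ 2 = c * (k / n) := Real.sq_sqrt (by positivity)
  have hs : √(c * (k / n)) ≤ 1 - M₁ / M₀ := Real.sqrt_le_iff.2 ⟨hr, by nlinarith⟩
  have key := ofReal_le_minimaxRisk (n := n) (k := k) (M₁ := M₁) (signVector p k) hM₀
    (Real.sqrt_nonneg (c * (k / n))) (by rw [hs2]; nlinarith)
    (by
      have h1 : M₀ * (M₁ / M₀) = M₁ := by field_simp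
      nlinarith)
    (norm_signVector hk hkp)
    (fun ε i j hij => by
      by_cases hi : (i : ℕ) < k
      · by_cases hj : (j : ℕ) < k
        · exfalso
          rw [lt_abs] at hij
          omega
        · simp [signVector, hj]
      · simp [signVector, hi])
    (by
      have h2 : ∀ ε : Fin k → Bool, ∑ δ, Real.exp (n * √(c * (k / n)) ^ 2 *
          inner ℝ (signVector p k ε) (signVector p k δ) ^ 2) ≤ 2 * 2 ^ k := by
        intro ε
        refine le_trans (le_of_eq ?_) (sum_exp_sq_signed_sum_le hk hc0 hc1
          (fun i => if ε i then 1 else -1) fun i => by split_ifs <;> norm_num)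
        refine Finset.sum_congr rfl fun δ _ => ?_
        rw [inner_signVector hkp, hs2]
        congr 1
        field_simp
      calc _ ≤ ∑ _ε : Fin k → Bool, (2 * 2 ^ k : ℝ) := Finset.sum_le_sum fun ε _ => h2 ε
        _ = _ := by
          simp
          ring)
  refine le_trans (le_of_eq ?_) key
  rw [hs2]
  congr 1
  ring

/-- Coordinate vectors give diagonal covariances, hence every bandwidth is allowed. The factor `min
((M₀ - M₁) ^ 2) 1` enters `s²` because the sample size hypothesis bounds `log p / n` only after
multiplication by it. -/
theorem log_dim_le_minimaxRisk {n p k : ℕ} {M₀ M₁ : ℝ} (hM₁ : 0 < M₁)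
    (hM : M₁ < M₀) (hn : 1 ≤ n) (hp : 1 ≤ p)
    (hpn : min ((M₀ - M₁) ^ 2) 1 * Real.log p ≤ n / 2) :
    ENNReal.ofReal (M₀ ^ 2 * (min ((M₀ - M₁) ^ 2) 1 * min (1 / 2) ((1 - M₁ / M₀) ^ 2)) / 8 *
      (Real.log p / n)) ≤ minimaxRisk n p k M₀ M₁ := by
  have hM₀ : 0 < M₀ := hM₁.trans hM
  have hn' : (0 : ℝ) < n := by exact_mod_cast hn
  have hp' : (1 : ℝ) ≤ p := by exact_mod_cast hp
  have hlog : 0 ≤ Real.log p := Real.log_nonneg hp'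
  set m : ℝ := min ((M₀ - M₁) ^ 2) 1
  set c : ℝ := min (1 / 2) ((1 - M₁ / M₀) ^ 2)
  have hr : 0 ≤ 1 - M₁ / M₀ := by rw [sub_nonneg, div_le_one hM₀]; exact hM.le
  have hm0 : 0 ≤ m := by positivity
  have hm1 : m ≤ 1 := min_le_right _ _
  have hc0 : 0 ≤ c := by positivity
  have hc1 : c ≤ 1 / 2 := min_le_left _ _
  have hc2 : c ≤ (1 - M₁ / M₀) ^ 2 := min_le_right _ _
  have hle : m * (Real.log p / n) ≤ 1 / 2 := by
    rw [← mul_div_assoc, div_le_iff₀ hn']; linarith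
  have hle0 : 0 ≤ m * (Real.log p / n) := by positivity
  set u : ℝ := m * c * (Real.log p / n)
  have hu : u = c * (m * (Real.log p / n)) := by ring
  have hs2 : √u ^ 2 = u := Real.sq_sqrt (by positivity)
  have hs : √u ≤ 1 - M₁ / M₀ := Real.sqrt_le_iff.2 ⟨hr, by nlinarith⟩
  have : Nonempty (Fin p) := ⟨⟨0, hp⟩⟩
  have key := ofReal_le_minimaxRisk (n := n) (k := k) (M₁ := M₁)
    (fun a : Fin p => EuclideanSpace.single a (1 : ℝ)) hM₀
    (Real.sqrt_nonneg u) (by rw [hs2]; nlinarith)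
    (by
      have h1 : M₀ * (M₁ / M₀) = M₁ := by field_simp
      nlinarith)
    (by simp)
    (fun a i j hij => by
      have hne : i ≠ j := by
        rintro rfl
        simp at hij
        omega
      by_cases hi : i = a
      · simp [show j ≠ a from fun h => hne (hi.trans h.symm)]
      · simp [hi])
    (by
      have hexp : Real.exp (n * u) ≤ p := by
        have h1 : n * u ≤ Real.log p := by
          have : n * u = m * c * Real.log p := by simp only [u]; field_simp
          rw [this]
          exact mul_le_of_le_one_left hlog (by nlinarith)
        calc _ ≤ Real.exp (Real.log p) := Real.exp_le_exp.2 h1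
          _ = p := Real.exp_log (by linarith)
      have h2 : ∀ a : Fin p, ∑ b, Real.exp (n * √u ^ 2 * inner ℝ (EuclideanSpace.single a (1 : ℝ))
          (EuclideanSpace.single b (1 : ℝ)) ^ 2) ≤ 2 * p := by
        intro a
        -- Orthogonal pairs contribute 1 each, and the diagonal pair contributes `exp (n u) ≤ p`.
        calc _ ≤ ∑ b, (1 + if b = a then (p : ℝ) else 0) := by
              refine Finset.sum_le_sum fun b _ => ?_
              rw [hs2]
              by_cases hb : b = a
              · subst hb
                simp
                linarith
              · simp [hb, EuclideanSpace.inner_single_left]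
          _ = 2 * p := by
            rw [Finset.sum_add_distrib]
            simp
            ring
      calc _ ≤ ∑ _a : Fin p, (2 * p : ℝ) := Finset.sum_le_sum fun a _ => h2 a
        _ = _ := by
          simp
          ring)
  refine le_trans (le_of_eq ?_) key
  rw [hs2]
  congr 1
  simp only [u]
  ring

end BandedCovariance

theorem theorem2 (M₀ M₁ : ℝ) (hM₁ : 0 < M₁) (hM : M₁ < M₀) :
    ∃ C : ℝ, 0 < C ∧ ∀ n p k : ℕ, 1 ≤ n → 1 ≤ p → k ≤ p →
      max (min ((M₀ - M₁) ^ 2) 1 * Real.log p) (k : ℝ) ≤ (n : ℝ) / 2 →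
        ENNReal.ofReal (C * (((k : ℝ) + Real.log p) / n)) ≤
          BandedCovariance.minimaxRisk n p k M₀ M₁ := by
  have hM₀ : 0 < M₀ := hM₁.trans hM
  have hr : 0 < 1 - M₁ / M₀ := by rw [sub_pos, div_lt_one hM₀]; exact hM
  have hd : 0 < M₀ - M₁ := by linarith
  set A : ℝ := M₀ ^ 2 * min (3 / 8) ((1 - M₁ / M₀) ^ 2) / 8 with hA
  set B : ℝ := M₀ ^ 2 * (min ((M₀ - M₁) ^ 2) 1 * min (1 / 2) ((1 - M₁ / M₀) ^ 2)) / 8 with hB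
  have hA0 : 0 < A := by positivity
  have hB0 : 0 < B := by positivity
  -- The factor `1 / 2` passes from the maximum of the two bounds to their sum.
  refine ⟨min A B / 2, by positivity, fun n p k hn hp hkp hmax => ?_⟩
  have h1 := BandedCovariance.bandwidth_le_minimaxRisk (k := k) hM₁ hM hn hkp
    ((le_max_right _ _).trans hmax)
  have h2 := BandedCovariance.log_dim_le_minimaxRisk (k := k) hM₁ hM hn hp
    ((le_max_left _ _).trans hmax)
  rw [← hA] at h1
  rw [← hB] at h2
  have hlog : 0 ≤ Real.log p := Real.log_nonneg (by exact_mod_cast hp)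
  have hkn : (0 : ℝ) ≤ k / n := by positivity
  have hpn : 0 ≤ Real.log p / n := by positivity
  have h3 : min A B / 2 * (((k : ℝ) + Real.log p) / n) ≤
      max (A * (k / n)) (B * (Real.log p / n)) := by
    have e1 : min A B * (k / n) ≤ A * (k / n) := by gcongr; exact min_le_left _ _
    have e2 : min A B * (Real.log p / n) ≤ B * (Real.log p / n) := by
      gcongr; exact min_le_right _ _
    have e3 := le_max_left (A * (k / n)) (B * (Real.log p / n))
    have e4 := le_max_right (A * (k / n)) (B * (Real.log p / n))
    rw [add_div]
    linarith
  refine (ENNReal.ofReal_le_ofReal h3).trans ?_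
  rcases max_choice (A * (k / n)) (B * (Real.log p / n)) with h | h <;> rw [h] <;> assumption
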